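/- \textbf{Strong consistency, layer 1.} Let $A^\ast\in\mathbb R^{d\times d}$ be an entrywise nonnegative matrix of full rank, let $\mu$ be a probability distribution on $\mathbb R^d$ with support $\mathbb R^d$ and $\mathbb E_{\mathbf x\sim\mu}\|\mathbf x\|^2<\infty$, and consider the single-layer model $\mathbf h=(A^\ast\mathbf x)^+$, where $[c^+]_j=\max\{0,c_j\}$. Let $\mathbf x^{(1)},\mathbf x^{(2)},\dots$ and $\mathbf z^{(1)},\mathbf z^{(2)},\dots$ be two sequences of random vectors on a common probability space, each of them i.i.d. with law $\mu$ (the two sequences may be the same, independent of each other, or dependent in any other way). For each $n$, let $\hat A_n$ be obtained from the samples $(\mathbf x^{(i)},\mathbf h^{(i)})_{i\le n}$, $\mathbf h^{(i)}=(A^\ast\mathbf x^{(i)})^+$, by solving (almost surely) the quadratic program $$\min_{A,\,\phi^{(1)},\dots,\phi^{(n)}}\ \frac1{2n}\sum_{i=1}^n\bigl\|\phi^{(i)}+A\mathbf x^{(i)}-\mathbf h^{(i)}\bigr\|^2\quad\text{s.t. }\phi^{(i)}\ge 0\ (1\le i\le n),$$ $\hat A_n$ being the $A$-part of an arbitrary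 minimizer, or the linear program $$\min_A\ \mathrm{const}\quad\text{s.t. }\mathbf h^{(i)}-A\mathbf x^{(i)}\ge 0\ (1\le i\le n),$$ $\hat A_n$ being an arbitrary feasible point. Here $\ge$ is entrywise. Assume that the solver returns a solution with scale factor $0$ with probability $0$, i.e. for all $n\ge1$ and all $j$, the $j$-th row of $\hat A_n$ is almost surely nonzero. For each $n$, $m$ and $j$ let $\hat k_{n,m,j}$ be (almost surely) a linear least squares estimate of $k$ in the model $\hat A_{n,j,:}\,\mathbf z=k\,[(A^\ast\mathbf z)^+]_j$ on those of the samples $\mathbf z^{(1)},\dots,\mathbf z^{(m)}$ with $[(A^\ast\mathbf z^{(i)})^+]_j>0$, that is, a minimizer of the mean squared error over these samples. Let $\tilde A_{n,m}$ be $\hat A_n$ with its $j$-th row divided by $\hat k_{n,m,j}$, for every $j\in\{1,\dots,d\}$. Then, almost surely, $\tilde A_{n,m}\to A^\ast$ as $n,m\to\infty$ (jointly, i.e. as $\min\{n,m\}\to\infty$). -/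

import Mathlib

open MeasureTheory ProbabilityTheory Filter Topology

noncomputable section

namespace ResidualUnit

variable {d n : ℕ}

/-- The entrywise rectifier `[c⁺]_j = max {0, c_j}`. -/
def relu (c : EuclideanSpace ℝ (Fin d)) : EuclideanSpace ℝ (Fin d) :=
  WithLp.toLp 2 fun j => max 0 (c j)

/-- The hidden output `h = (A x)⁺` of the single-layer model with weights `A`. -/
def hiddenOutput (A : Matrix (Fin d) (Fin d) ℝ) (x : EuclideanSpace ℝ (Fin d)) :
    EuclideanSpace ℝ (Fin d) :=
  relu (A.toEuclideanLin x)

/-- The empirical layer 1 objective with nonparametric estimation,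
`1/(2n) * ∑ i, ‖φ⁽ⁱ⁾ + A x⁽ⁱ⁾ - h⁽ⁱ⁾‖²` (Euclidean norm). -/
def qpObjective (x h : Fin n → EuclideanSpace ℝ (Fin d)) (A : Matrix (Fin d) (Fin d) ℝ)
    (φ : Fin n → EuclideanSpace ℝ (Fin d)) : ℝ :=
  1 / (2 * (n : ℝ)) * ∑ i, ‖φ i + A.toEuclideanLin (x i) - h i‖ ^ 2

/-- The feasible region of the QP in the variable `φ`: every `φ⁽ⁱ⁾` is entrywise nonnegative. -/
def qpFeasible (φ : Fin n → EuclideanSpace ℝ (Fin d)) : Prop :=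
  ∀ i j, 0 ≤ φ i j

/-- `(A, φ)` solves the layer 1 QP: it is feasible and minimizes the objective among all
feasible pairs. -/
def IsQPSolution (x h : Fin n → EuclideanSpace ℝ (Fin d)) (A : Matrix (Fin d) (Fin d) ℝ)
    (φ : Fin n → EuclideanSpace ℝ (Fin d)) : Prop :=
  qpFeasible φ ∧
    ∀ (A' : Matrix (Fin d) (Fin d) ℝ) (φ' : Fin n → EuclideanSpace ℝ (Fin d)),
      qpFeasible φ' → qpObjective x h A φ ≤ qpObjective x h A' φ'

/-- `A` solves the layer 1 LP. The objective of the LP is constant, so that its solutions are its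
feasible points: `h⁽ⁱ⁾ - A x⁽ⁱ⁾ ≥ 0` entrywise for every sample. -/
def IsLPSolution (x h : Fin n → EuclideanSpace ℝ (Fin d)) (A : Matrix (Fin d) (Fin d) ℝ) : Prop :=
  ∀ i j, 0 ≤ (h i - A.toEuclideanLin (x i)) j

/-- `A` is obtained by solving the layer 1 QP (and forgetting `φ`) or the layer 1 LP. -/
def IsQPLPSolution (x h : Fin n → EuclideanSpace ℝ (Fin d)) (A : Matrix (Fin d) (Fin d) ℝ) :
    Prop :=
  (∃ φ, IsQPSolution x h A φ) ∨ IsLPSolution x h A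

/-- The empirical risk `1/(2|s|) * ∑ i ∈ s, (k u⁽ⁱ⁾ - v⁽ⁱ⁾)²` of the scalar linear model `v = k u`
on the samples with index in `s`. -/
def lrRisk {ι : Type*} (s : Finset ι) (u v : ι → ℝ) (k : ℝ) : ℝ :=
  1 / (2 * (s.card : ℝ)) * ∑ i ∈ s, (k * u i - v i) ^ 2

/-- `k` is a linear regression (least squares) estimate of the model `v = k u` from the samples
with index in `s`. -/
def IsLR {ι : Type*} (s : Finset ι) (u v : ι → ℝ) (k : ℝ) : Prop :=
  ∀ k' : ℝ, lrRisk s u v k ≤ lrRisk s u v k'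

/-- `k` is a layer 1 scale factor estimate for `A`: for every `j`, `k j` is a linear regression
estimate of the model `A_{j,:} x = k_j h_j` from the samples with `h_j > 0`. -/
def IsScaleFactor (x h : Fin n → EuclideanSpace ℝ (Fin d)) (A : Matrix (Fin d) (Fin d) ℝ)
    (k : Fin d → ℝ) : Prop :=
  ∀ j, IsLR (Finset.univ.filter fun i => 0 < h i j) (fun i => h i j)
    (fun i => A.toEuclideanLin (x i) j) (k j)

/-- The matrix `A` with its `j`-th row divided by `k j`, for every `j`. -/
def rescale (A : Matrix (Fin d) (Fin d) ℝ) (k : Fin d → ℝ) : Matrix (Fin d) (Fin d) ℝ :=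
  Matrix.of fun j l => A j l / k j

end ResidualUnit

end

/-!
The argument reduces to one row of the matrices, a vector `aₙ` estimating the row `a` of
`Astar`, which is nonzero by the full rank of `Astar`, and separates the direction of `aₙ` from its
length.

*Direction.* The quadratic program attains the value `0` at `A = 0`, `φ = h`, so its solutions are
feasible points of the linear program: `⟪aₙ, xᵢ⟫ ≤ max 0 ⟪a, xᵢ⟫` for `i < n`
(`isLPSolution_of_isQPLPSolution`). In particular `⟪aₙ, xᵢ⟫ ≤ 0` at every sample with
`⟪a, xᵢ⟫ ≤ 0`, a condition that does not depend on the length of `aₙ`. As `μ` has full support, the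
samples are almost surely dense (`ae_denseRange_of_iid`). A cluster point of the normalized `aₙ` is
therefore a unit vector that is nonpositive on the open half-space `⟪a, x⟫ < 0`, which forces it to
be the normalization of `a`; by compactness of the sphere the normalized `aₙ` converge to it
(`tendsto_normalize_of_halfspace`). The vectors `aₙ` themselves need not converge.

*Length.* With `hᵢ = max 0 ⟪a, zᵢ⟫`, the normal equation reads
`k * ∑ hᵢ² = ∑ hᵢ ⟪aₙ, zᵢ⟫`, and for `aₙ` replaced by `a` its solution is exactly `1`, since
`hᵢ ⟪a, zᵢ⟫ = hᵢ²`. The error made by this replacement, after normalization, is at most the distance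
of the two directions times `∑ hᵢ ‖zᵢ‖ / ∑ hᵢ²`, which converges as `m → ∞` by the strong law
of large numbers. Hence dividing by `k` restores the length of `a` in the limit, jointly in `n` and
`m` (`tendsto_rescaled_of_normalEquation`).
-/

namespace ResidualUnit

/-! ### Directions determined by a half-space -/

section Direction

variable {E : Type*} [NormedAddCommGroup E] [InnerProductSpace ℝ E]

/-- A unit vector `u` that is nonpositive on the open half-space `⟪b, x⟫ < 0` equals the unit
vector `b`. -/
lemma eq_of_halfspace_inner_nonpos {b u : E} (hb : ‖b‖ = 1) (hu : ‖u‖ = 1)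
    (h : ∀ x, inner ℝ b x < 0 → inner ℝ u x ≤ 0) : u = b := by
  rw [← inner_eq_one_iff_of_norm_eq_one (𝕜 := ℝ) hu hb]
  have hle : inner ℝ u b ≤ 1 := by
    simpa [hb, hu] using real_inner_le_norm u b
  by_contra hne
  have hlt : inner ℝ u b < 1 := lt_of_le_of_ne hle hne
  -- Unless `⟪u, b⟫ = 1`, the vector `u - b` lies in the half-space and violates the hypothesis.
  have h1 := h (u - b) (by
    rw [inner_sub_right, real_inner_self_eq_norm_sq, hb, real_inner_comm]; linarith)
  rw [inner_sub_right, real_inner_self_eq_norm_sq, hu] at h1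
  linarith

/-- If `aₙ` is nonpositive at those of the first `n` points of a dense sequence at which `a` is
nonpositive, then the direction of `aₙ` converges to that of `a`. -/
lemma tendsto_normalize_of_halfspace [FiniteDimensional ℝ E] {a : E} (ha : a ≠ 0) {x : ℕ → E}
    (hx : DenseRange x) {aₙ : ℕ → E} (hne : ∀ᶠ n in atTop, aₙ n ≠ 0)
    (h : ∀ n, ∀ i < n, inner ℝ a (x i) ≤ 0 → inner ℝ (aₙ n) (x i) ≤ 0) :
    Tendsto (fun n => ‖aₙ n‖⁻¹ • aₙ n) atTop (𝓝 (‖a‖⁻¹ • a)) := by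
  have hunit : ∀ v : E, v ≠ 0 → ‖‖v‖⁻¹ • v‖ = 1 := fun v hv => by
    rw [norm_smul, norm_inv, norm_norm, inv_mul_cancel₀ (norm_ne_zero_iff.2 hv)]
  have : ProperSpace E := FiniteDimensional.proper ℝ E
  refine (isCompact_sphere (0 : E) 1).tendsto_nhds_of_unique_mapClusterPt ?_ ?_
  · filter_upwards [hne] with n hn
    simpa using hunit _ hn
  · intro u hu hcl
    refine eq_of_halfspace_inner_nonpos (hunit a ha) (by simpa using hu) fun y hy => ?_
    have hay : inner ℝ a y < 0 := by
      rw [real_inner_smul_left] at hy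
      exact (pos_iff_neg_of_mul_neg hy).1 (inv_pos.2 (norm_pos_iff.2 ha))
    have hpt : ∀ i, inner ℝ a (x i) < 0 → inner ℝ u (x i) ≤ 0 := by
      intro i hi
      have hclosed : IsClosed {v : E | inner ℝ v (x i) ≤ 0} :=
        isClosed_le (by fun_prop) continuous_const
      refine hclosed.mem_of_mapClusterPt hcl ?_
      filter_upwards [eventually_gt_atTop i] with n hn
      rw [real_inner_smul_left]
      exact mul_nonpos_of_nonneg_of_nonpos (by positivity) (h n i hn hi.le)
    by_contra hpos
    obtain ⟨i, hi⟩ := hx.exists_mem_open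
      (s := {v : E | inner ℝ a v < 0} ∩ {v : E | 0 < inner ℝ u v})
      ((isOpen_lt (by fun_prop) continuous_const).inter
        (isOpen_lt continuous_const (by fun_prop))) ⟨y, hay, not_le.1 hpos⟩
    exact absurd (hpt i hi.1) (not_le.2 hi.2)

/-! ### Restoring the length by least squares -/

/-- The factors `k n m` solve the normal equations of the model `⟪aₙ, z⟫ = k * max 0 ⟪a, z⟫`. If the
direction of `aₙ` converges to that of `a`, and the two empirical moments that control the error
converge, then `aₙ` divided by `k n m` converges to `a` jointly in `n` and `m`. -/
lemma tendsto_rescaled_of_normalEquation {a : E} (ha : a ≠ 0) {aₙ : ℕ → E}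
    (hne : ∀ᶠ n in atTop, aₙ n ≠ 0)
    (hdir : Tendsto (fun n => ‖aₙ n‖⁻¹ • aₙ n) atTop (𝓝 (‖a‖⁻¹ • a)))
    {z : ℕ → E} {k : ℕ → ℕ → ℝ} {c c' : ℝ} (hc : 0 < c)
    (hsq : Tendsto (fun m : ℕ => (∑ i ∈ Finset.range m, (max 0 (inner ℝ a (z i))) ^ 2) / m)
      atTop (𝓝 c))
    (hnorm : Tendsto (fun m : ℕ => (∑ i ∈ Finset.range m, max 0 (inner ℝ a (z i)) * ‖z i‖) / m)
      atTop (𝓝 c'))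
    (hk : ∀ n m, k n m * ∑ i ∈ Finset.range m, (max 0 (inner ℝ a (z i))) ^ 2 =
      ∑ i ∈ Finset.range m, max 0 (inner ℝ a (z i)) * inner ℝ (aₙ n) (z i)) :
    Tendsto (fun p : ℕ × ℕ => (k p.1 p.2)⁻¹ • aₙ p.1) (atTop ×ˢ atTop) (𝓝 a) := by
  set S : ℕ → ℝ := fun m => ∑ i ∈ Finset.range m, (max 0 (inner ℝ a (z i))) ^ 2 with hS
  set T : ℕ → ℝ := fun m => ∑ i ∈ Finset.range m, max 0 (inner ℝ a (z i)) * ‖z i‖ with hT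
  set u : ℕ → E := fun n => ‖aₙ n‖⁻¹ • aₙ n with hu
  set b : E := ‖a‖⁻¹ • a with hb
  have hna : ‖a‖ ≠ 0 := norm_ne_zero_iff.2 ha
  have hSpos : ∀ᶠ m in atTop, 0 < S m := by
    filter_upwards [hsq.eventually_const_lt hc, eventually_gt_atTop 0] with m hm hm0
    exact (div_pos_iff_of_pos_right (by exact_mod_cast hm0)).1 hm
  have hratio : Tendsto (fun m => T m / S m) atTop (𝓝 (c' / c)) := by
    refine (hnorm.div hsq hc.ne').congr' ?_
    filter_upwards [eventually_gt_atTop 0] with m hm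
    exact div_div_div_cancel_right₀ (by exact_mod_cast hm.ne') _ _
  have hgood : ∀ᶠ p : ℕ × ℕ in atTop ×ˢ atTop, aₙ p.1 ≠ 0 ∧ 0 < S p.2 := hne.prod_mk hSpos
  -- In exact direction `b` the normal equation has the solution `‖a‖⁻¹`.
  have hexact : ∀ m, ∑ i ∈ Finset.range m, max 0 (inner ℝ a (z i)) * inner ℝ b (z i)
      = ‖a‖⁻¹ * S m := by
    intro m
    rw [hS, Finset.mul_sum]
    refine Finset.sum_congr rfl fun i _ => ?_
    rw [hb, real_inner_smul_left]
    rcases le_total (inner ℝ a (z i)) 0 with hi | hi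
    · simp [max_eq_left hi]
    · rw [max_eq_right hi]; ring
  have hbound : ∀ᶠ p : ℕ × ℕ in atTop ×ˢ atTop,
      ‖‖aₙ p.1‖⁻¹ * k p.1 p.2 - ‖a‖⁻¹‖ ≤ ‖u p.1 - b‖ * (T p.2 / S p.2) := by
    filter_upwards [hgood] with p hp
    have hdiff : (‖aₙ p.1‖⁻¹ * k p.1 p.2 - ‖a‖⁻¹) * S p.2
        = ∑ i ∈ Finset.range p.2, max 0 (inner ℝ a (z i)) * inner ℝ (u p.1 - b) (z i) := by
      rw [sub_mul, mul_assoc, hk, ← hexact, Finset.mul_sum, ← Finset.sum_sub_distrib]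
      refine Finset.sum_congr rfl fun i _ => ?_
      rw [inner_sub_left, show u p.1 = ‖aₙ p.1‖⁻¹ • aₙ p.1 from rfl,
        real_inner_smul_left (aₙ p.1)]
      ring
    rw [← mul_div_assoc, le_div_iff₀ hp.2]
    calc ‖‖aₙ p.1‖⁻¹ * k p.1 p.2 - ‖a‖⁻¹‖ * S p.2
        = ‖(‖aₙ p.1‖⁻¹ * k p.1 p.2 - ‖a‖⁻¹) * S p.2‖ := by
          rw [norm_mul, Real.norm_of_nonneg hp.2.le]
      _ ≤ ∑ i ∈ Finset.range p.2, ‖max 0 (inner ℝ a (z i)) * inner ℝ (u p.1 - b) (z i)‖ := by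
          rw [hdiff]; exact norm_sum_le _ _
      _ ≤ ‖u p.1 - b‖ * T p.2 := by
          rw [hT, Finset.mul_sum]
          refine Finset.sum_le_sum fun i _ => ?_
          rw [norm_mul, Real.norm_of_nonneg (le_max_left _ _), mul_left_comm]
          exact mul_le_mul_of_nonneg_left (norm_inner_le_norm _ _) (le_max_left _ _)
  have hfac : Tendsto (fun p : ℕ × ℕ => ‖aₙ p.1‖⁻¹ * k p.1 p.2) (atTop ×ˢ atTop) (𝓝 ‖a‖⁻¹) := by
    rw [tendsto_iff_norm_sub_tendsto_zero]
    refine squeeze_zero' (Eventually.of_forall fun _ => norm_nonneg _) hbound ?_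
    simpa using ((tendsto_iff_norm_sub_tendsto_zero.1 hdir).comp tendsto_fst).mul
      (hratio.comp (tendsto_snd (f := (atTop : Filter ℕ)) (g := (atTop : Filter ℕ))))
  have hlim := (hfac.inv₀ (inv_ne_zero hna)).smul (hdir.comp (tendsto_fst (g := atTop)))
  rw [inv_inv, hb, smul_inv_smul₀ hna] at hlim
  refine hlim.congr' ?_
  filter_upwards [hgood] with p hp
  have hn : ‖aₙ p.1‖ ≠ 0 := norm_ne_zero_iff.2 hp.1
  rw [Function.comp_apply, hu, smul_smul, mul_inv, inv_inv, mul_comm ‖aₙ p.1‖, mul_assoc,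
    mul_inv_cancel₀ hn, mul_one]

end Direction

/-! ### Almost sure properties of i.i.d. samples -/

section Sampling

variable {E Ω : Type*} [MeasurableSpace E] [MeasurableSpace Ω] {μ : Measure E} {P : Measure Ω}
  {X : ℕ → Ω → E}

/-- The strong law of large numbers for an integrable function of an i.i.d. sample. -/
lemma ae_tendsto_average_comp (hindep : iIndepFun X P) (hlaw : ∀ i, HasLaw (X i) μ P)
    {f : E → ℝ} (hf : Measurable f) (hint : Integrable f μ) :
    ∀ᵐ ω ∂P, Tendsto (fun m : ℕ => (∑ i ∈ Finset.range m, f (X i ω)) / m) atTop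
      (𝓝 (∫ x, f x ∂μ)) := by
  have hid : ∀ i, IdentDistrib (X i) (X 0) P P := fun i =>
    ⟨(hlaw i).aemeasurable, (hlaw 0).aemeasurable, by rw [(hlaw i).map_eq, (hlaw 0).map_eq]⟩
  have h := strong_law_ae_real (μ := P) (fun i => f ∘ X i)
    (((hlaw 0).map_eq ▸ hint : Integrable f (P.map (X 0))).comp_aemeasurable (hlaw 0).aemeasurable)
    (fun i j hij => (hindep.indepFun hij).comp hf hf) (fun i => (hid i).comp hf)
  rw [(hlaw 0).integral_comp hf.aestronglyMeasurable] at h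
  exact h

/-- An i.i.d. sample almost surely hits a measurable set of positive probability. -/
lemma ae_exists_mem_of_pos [IsProbabilityMeasure P] (hindep : iIndepFun X P)
    (hlaw : ∀ i, HasLaw (X i) μ P) {U : Set E} (hU : MeasurableSet U) (hpos : 0 < μ U) :
    ∀ᵐ ω ∂P, ∃ i, X i ω ∈ U := by
  have : IsProbabilityMeasure μ := (hlaw 0).isProbabilityMeasure_iff.1 inferInstance
  filter_upwards [ae_tendsto_average_comp hindep hlaw
    ((measurable_const (a := (1 : ℝ))).indicator hU)
    ((integrable_const (1 : ℝ)).indicator hU)] with ω hω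
  -- Otherwise all averages of the indicator of `U` vanish, although they tend to the mass of `U`.
  by_contra! hno
  simp only [Set.indicator_of_notMem (hno _), Finset.sum_const_zero, zero_div] at hω
  have h0 := tendsto_nhds_unique hω tendsto_const_nhds
  rw [integral_indicator_const _ hU, smul_eq_mul, mul_one] at h0
  exact (measureReal_ne_zero_iff (measure_ne_top μ U)).2 hpos.ne' h0

/-- An i.i.d. sample from a law of full support is almost surely dense. -/
lemma ae_denseRange_of_iid [TopologicalSpace E] [SecondCountableTopology E]
    [OpensMeasurableSpace E] [IsProbabilityMeasure P] (hindep : iIndepFun X P)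
    (hlaw : ∀ i, HasLaw (X i) μ P) (hsupp : μ.support = Set.univ) :
    ∀ᵐ ω ∂P, DenseRange fun i => X i ω := by
  have hB := TopologicalSpace.isBasis_countableBasis E
  have hhit : ∀ᵐ ω ∂P, ∀ U ∈ TopologicalSpace.countableBasis E, ∃ i, X i ω ∈ U := by
    rw [ae_ball_iff (TopologicalSpace.countable_countableBasis E)]
    intro U hU
    obtain ⟨x, hx⟩ := TopologicalSpace.nonempty_of_mem_countableBasis hU
    have hopen := TopologicalSpace.isOpen_of_mem_countableBasis hU
    exact ae_exists_mem_of_pos hindep hlaw hopen.measurableSet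
      ((Measure.mem_support_iff_forall x).1 (hsupp ▸ Set.mem_univ x) U (hopen.mem_nhds hx))
  filter_upwards [hhit] with ω hω
  refine hB.dense_iff.2 fun U hU _ => ?_
  obtain ⟨i, hi⟩ := hω U hU
  exact ⟨X i ω, hi, i, rfl⟩

end Sampling

/-! ### The optimization problems -/

section Programs

variable {d n : ℕ}

/-- The `j`-th row of a matrix, as a vector of Euclidean space. -/
def euclideanRow (A : Matrix (Fin d) (Fin d) ℝ) (j : Fin d) : EuclideanSpace ℝ (Fin d) :=
  WithLp.toLp 2 (A j)

lemma toEuclideanLin_apply_eq_inner (A : Matrix (Fin d) (Fin d) ℝ) (x : EuclideanSpace ℝ (Fin d))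
    (j : Fin d) : A.toEuclideanLin x j = inner ℝ (euclideanRow A j) x := by
  simp [euclideanRow, Matrix.toLpLin_apply, Matrix.mulVec, dotProduct, PiLp.inner_apply, mul_comm]

lemma hiddenOutput_apply (A : Matrix (Fin d) (Fin d) ℝ) (x : EuclideanSpace ℝ (Fin d))
    (j : Fin d) : hiddenOutput A x j = max 0 (inner ℝ (euclideanRow A j) x) := by
  rw [← toEuclideanLin_apply_eq_inner]
  rfl

/-- Solutions of the quadratic program are feasible for the linear program, as the choice `A = 0`,
`φ = h` makes the objective vanish. -/
lemma isLPSolution_of_isQPLPSolution {x h : Fin n → EuclideanSpace ℝ (Fin d)}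
    (hh : ∀ i j, 0 ≤ h i j) {A : Matrix (Fin d) (Fin d) ℝ} (hA : IsQPLPSolution x h A) :
    IsLPSolution x h A := by
  obtain ⟨φ, hφ, hmin⟩ | hA := hA
  · intro i j
    have hn : (0 : ℝ) < n := by exact_mod_cast i.pos
    have hle := hmin 0 h hh
    simp only [qpObjective, map_zero, LinearMap.zero_apply, add_zero, sub_self, norm_zero] at hle
    have hsum : ∑ i, ‖φ i + A.toEuclideanLin (x i) - h i‖ ^ 2 ≤ 0 := by
      simp only [ne_eq, OfNat.ofNat_ne_zero, not_false_eq_true, zero_pow, Finset.sum_const_zero,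
        mul_zero] at hle
      exact nonpos_of_mul_nonpos_right hle (by positivity)
    have hzero := (Finset.sum_eq_zero_iff_of_nonneg fun i _ => sq_nonneg _).1
      (hsum.antisymm (Finset.sum_nonneg fun i _ => sq_nonneg _)) i (Finset.mem_univ i)
    have heq : φ i = h i - A.toEuclideanLin (x i) := by
      rw [pow_eq_zero_iff two_ne_zero, norm_eq_zero, sub_eq_zero] at hzero
      exact eq_sub_of_add_eq hzero
    rw [← heq]
    exact hφ i j
  · exact hA

lemma IsQPLPSolution.inner_row_le {Astar A : Matrix (Fin d) (Fin d) ℝ}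
    {x : ℕ → EuclideanSpace ℝ (Fin d)}
    (hA : IsQPLPSolution (fun i : Fin n => x i) (fun i : Fin n => hiddenOutput Astar (x i)) A)
    (j : Fin d) {i : ℕ} (hi : i < n) :
    inner ℝ (euclideanRow A j) (x i) ≤ max 0 (inner ℝ (euclideanRow Astar j) (x i)) := by
  have hh : ∀ (i : Fin n) (j : Fin d), 0 ≤ hiddenOutput Astar (x i) j := fun i j => by
    rw [hiddenOutput_apply]
    exact le_max_left _ _
  have hlp : 0 ≤ (hiddenOutput Astar (x i) - A.toEuclideanLin (x i)) j :=
    isLPSolution_of_isQPLPSolution hh hA ⟨i, hi⟩ j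
  rwa [PiLp.sub_apply, hiddenOutput_apply, toEuclideanLin_apply_eq_inner, sub_nonneg] at hlp

/-- The normal equation of the scalar least squares problem. If `u` vanishes on `s`, both sides are
`0` and `k` is arbitrary. -/
lemma IsLR.normalEquation {ι : Type*} {s : Finset ι} {u v : ι → ℝ} {k : ℝ} (h : IsLR s u v k) :
    k * ∑ i ∈ s, u i ^ 2 = ∑ i ∈ s, u i * v i := by
  have hexp : ∀ k : ℝ, ∑ i ∈ s, (k * u i - v i) ^ 2
      = k ^ 2 * ∑ i ∈ s, u i ^ 2 - 2 * k * ∑ i ∈ s, u i * v i + ∑ i ∈ s, v i ^ 2 := by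
    intro k
    rw [Finset.mul_sum, Finset.mul_sum, ← Finset.sum_sub_distrib, ← Finset.sum_add_distrib]
    exact Finset.sum_congr rfl fun i _ => by ring
  rcases (Finset.sum_nonneg fun i _ => sq_nonneg (u i) : 0 ≤ ∑ i ∈ s, u i ^ 2).eq_or_lt with h0 | h0
  · have hu := (Finset.sum_eq_zero_iff_of_nonneg fun i _ => sq_nonneg (u i)).1 h0.symm
    rw [← h0, mul_zero, Finset.sum_eq_zero fun i hi => by
      rw [(pow_eq_zero_iff two_ne_zero).1 (hu i hi), zero_mul]]
  · have hs : s.Nonempty := Finset.nonempty_of_sum_ne_zero h0.ne'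
    have hcard : (0 : ℝ) < s.card := by exact_mod_cast hs.card_pos
    have hle := le_of_mul_le_mul_left (h ((∑ i ∈ s, u i * v i) / ∑ i ∈ s, u i ^ 2)) (by positivity)
    rw [hexp, hexp] at hle
    generalize ∑ i ∈ s, u i ^ 2 = S at *
    generalize ∑ i ∈ s, u i * v i = T at *
    -- Comparison with the vertex `T / S` of the parabola leaves `(k * S - T) ^ 2 ≤ 0`.
    have hmin : (T / S) ^ 2 * S - 2 * (T / S) * T = -(T ^ 2 / S) := by field_simp; ring
    have hmul : (k ^ 2 * S - 2 * k * T) * S ≤ -(T ^ 2) := by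
      rw [← le_div_iff₀ h0, neg_div]
      linarith
    have hsq : (k * S - T) ^ 2 = 0 := le_antisymm (by nlinarith) (sq_nonneg _)
    exact sub_eq_zero.1 ((pow_eq_zero_iff two_ne_zero).1 hsq)

/-- The normal equation of a scale factor. The samples with `h = 0`, which the regression leaves
out, contribute nothing to either sum. -/
lemma IsScaleFactor.normalEquation {Astar A : Matrix (Fin d) (Fin d) ℝ}
    {z : ℕ → EuclideanSpace ℝ (Fin d)} {k : Fin d → ℝ}
    (h : IsScaleFactor (fun i : Fin n => z i) (fun i : Fin n => hiddenOutput Astar (z i)) A k)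
    (j : Fin d) :
    k j * ∑ i ∈ Finset.range n, (max 0 (inner ℝ (euclideanRow Astar j) (z i))) ^ 2 =
      ∑ i ∈ Finset.range n, max 0 (inner ℝ (euclideanRow Astar j) (z i)) *
        inner ℝ (euclideanRow A j) (z i) := by
  have hj := (h j).normalEquation
  simp only [hiddenOutput_apply, toEuclideanLin_apply_eq_inner] at hj
  rw [Finset.sum_filter_of_ne, Finset.sum_filter_of_ne] at hj
  · rwa [← Fin.sum_univ_eq_sum_range
        (fun i => (max 0 (inner ℝ (euclideanRow Astar j) (z i))) ^ 2),
      ← Fin.sum_univ_eq_sum_range (fun i => max 0 (inner ℝ (euclideanRow Astar j) (z i)) *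
        inner ℝ (euclideanRow A j) (z i))]
  · intro i _ hi
    exact lt_of_le_of_ne (le_max_left _ _) (left_ne_zero_of_mul hi).symm
  · intro i _ hi
    exact lt_of_le_of_ne (le_max_left _ _) (ne_zero_pow two_ne_zero hi).symm

end Programs

/-! ### Moments of the hidden output -/

section Moments

variable {E : Type*} [NormedAddCommGroup E] [InnerProductSpace ℝ E] [MeasurableSpace E]
  [BorelSpace E] [SecondCountableTopology E] {μ : Measure E}

lemma integrable_relu_inner_mul_norm (hμ : Integrable (fun x => ‖x‖ ^ 2) μ) (a : E) :
    Integrable (fun x => max 0 (inner ℝ a x) * ‖x‖) μ := by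
  refine (hμ.const_mul ‖a‖).mono' (by fun_prop) (Eventually.of_forall fun x => ?_)
  have h0 : 0 ≤ max 0 (inner ℝ a x) := le_max_left _ _
  rw [Real.norm_of_nonneg (by positivity), sq, ← mul_assoc]
  exact mul_le_mul_of_nonneg_right (max_le (by positivity) (real_inner_le_norm a x)) (norm_nonneg x)

lemma integrable_relu_inner_sq (hμ : Integrable (fun x => ‖x‖ ^ 2) μ) (a : E) :
    Integrable (fun x => (max 0 (inner ℝ a x)) ^ 2) μ := by
  refine (hμ.const_mul (‖a‖ ^ 2)).mono' (by fun_prop) (Eventually.of_forall fun x => ?_)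
  rw [Real.norm_of_nonneg (by positivity), ← mul_pow]
  exact pow_le_pow_left₀ (le_max_left _ _) (max_le (by positivity) (real_inner_le_norm a x)) 2

lemma integral_relu_inner_sq_pos (hμ : Integrable (fun x => ‖x‖ ^ 2) μ)
    (hsupp : μ.support = Set.univ) {a : E} (ha : a ≠ 0) :
    0 < ∫ x, (max 0 (inner ℝ a x)) ^ 2 ∂μ := by
  rw [integral_pos_iff_support_of_nonneg (fun x => sq_nonneg _) (integrable_relu_inner_sq hμ a)]
  have hopen : IsOpen {x : E | 0 < inner ℝ a x} := isOpen_lt continuous_const (by fun_prop)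
  have hmem : a ∈ {x : E | 0 < inner ℝ a x} := real_inner_self_pos.2 ha
  refine ((Measure.mem_support_iff_forall a).1 (hsupp ▸ Set.mem_univ a) _
    (hopen.mem_nhds hmem)).trans_le (measure_mono fun x hx => ?_)
  exact (pow_pos (lt_max_of_lt_right hx) 2).ne'

end Moments

lemma euclideanRow_ne_zero_of_rank_eq {d : ℕ} {A : Matrix (Fin d) (Fin d) ℝ} (hA : A.rank = d)
    (j : Fin d) : euclideanRow A j ≠ 0 := by
  intro h
  have hli : LinearIndependent ℝ A.row := by
    rw [linearIndependent_iff_card_eq_finrank_span, Set.finrank, ← A.rank_eq_finrank_span_row, hA,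
      Fintype.card_fin]
  exact hli.ne_zero j ((WithLp.toLp_eq_zero 2).1 h)

end ResidualUnit

/-- Strong consistency of the layer 1 estimator. `X` are the inputs of the samples for the QP/LP and
`Z` those for the scale factors; they may coincide, be independent, or depend on each other in any
other way. `Ahat n` is the QP/LP solution from `n` samples, and `khat n m` is the scale factor
estimate for `Ahat n` from `m` samples. -/
theorem mainTheorem8 {d : ℕ} (Astar : Matrix (Fin d) (Fin d) ℝ)
    (hA_nonneg : ∀ j l, 0 ≤ Astar j l) (hA_rank : Astar.rank = d)
    (μ : Measure (EuclideanSpace ℝ (Fin d)))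
    (hμ_supp : μ.support = Set.univ)
    (hμ_moment : Integrable (fun x => ‖x‖ ^ 2) μ)
    {Ω : Type*} [MeasurableSpace Ω] (P : Measure Ω) [IsProbabilityMeasure P]
    (X Z : ℕ → Ω → EuclideanSpace ℝ (Fin d))
    (hX_indep : iIndepFun X P) (hX_law : ∀ i, HasLaw (X i) μ P)
    (hZ_indep : iIndepFun Z P) (hZ_law : ∀ i, HasLaw (Z i) μ P)
    (Ahat : ℕ → Ω → Matrix (Fin d) (Fin d) ℝ)
    (hAhat : ∀ n, ∀ᵐ ω ∂P, ResidualUnit.IsQPLPSolution (fun i : Fin n => X i ω)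
      (fun i : Fin n => ResidualUnit.hiddenOutput Astar (X i ω)) (Ahat n ω))
    (hAhat_ne : ∀ n, 0 < n → ∀ j, ∀ᵐ ω ∂P, (Ahat n ω).row j ≠ 0)
    (khat : ℕ → ℕ → Ω → Fin d → ℝ)
    (hkhat : ∀ n m, ∀ᵐ ω ∂P, ResidualUnit.IsScaleFactor (fun i : Fin m => Z i ω)
      (fun i : Fin m => ResidualUnit.hiddenOutput Astar (Z i ω)) (Ahat n ω) (khat n m ω)) :
    ∀ᵐ ω ∂P, Tendsto (fun p : ℕ × ℕ => ResidualUnit.rescale (Ahat p.1 ω) (khat p.1 p.2 ω))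
      (atTop ×ˢ atTop) (𝓝 Astar) := by
  have hXdense := ResidualUnit.ae_denseRange_of_iid hX_indep hX_law hμ_supp
  have hsq : ∀ᵐ ω ∂P, ∀ j, Tendsto (fun m : ℕ => (∑ i ∈ Finset.range m,
      (max 0 (inner ℝ (ResidualUnit.euclideanRow Astar j) (Z i ω))) ^ 2) / m) atTop
      (𝓝 (∫ x, (max 0 (inner ℝ (ResidualUnit.euclideanRow Astar j) x)) ^ 2 ∂μ)) :=
    ae_all_iff.2 fun j => ResidualUnit.ae_tendsto_average_comp hZ_indep hZ_law
      (f := fun x => (max 0 (inner ℝ (ResidualUnit.euclideanRow Astar j) x)) ^ 2)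
      (by fun_prop) (ResidualUnit.integrable_relu_inner_sq hμ_moment _)
  have hnorm : ∀ᵐ ω ∂P, ∀ j, Tendsto (fun m : ℕ => (∑ i ∈ Finset.range m,
      max 0 (inner ℝ (ResidualUnit.euclideanRow Astar j) (Z i ω)) * ‖Z i ω‖) / m) atTop
      (𝓝 (∫ x, max 0 (inner ℝ (ResidualUnit.euclideanRow Astar j) x) * ‖x‖ ∂μ)) :=
    ae_all_iff.2 fun j => ResidualUnit.ae_tendsto_average_comp hZ_indep hZ_law
      (f := fun x => max 0 (inner ℝ (ResidualUnit.euclideanRow Astar j) x) * ‖x‖)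
      (by fun_prop) (ResidualUnit.integrable_relu_inner_mul_norm hμ_moment _)
  have hne : ∀ᵐ ω ∂P, ∀ n, 0 < n → ∀ j, (Ahat n ω).row j ≠ 0 :=
    ae_all_iff.2 fun n => eventually_imp_distrib_left.2 fun hn => ae_all_iff.2 (hAhat_ne n hn)
  have hk := ae_all_iff.2 fun n => ae_all_iff.2 (hkhat n)
  filter_upwards [hXdense, hsq, hnorm, hne, hk, ae_all_iff.2 hAhat] with ω hω_dense hω_sq hω_norm
    hω_ne hω_k hω_A
  have hrow : ∀ j, Tendsto (fun p : ℕ × ℕ =>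
      (khat p.1 p.2 ω j)⁻¹ • ResidualUnit.euclideanRow (Ahat p.1 ω) j) (atTop ×ˢ atTop)
      (𝓝 (ResidualUnit.euclideanRow Astar j)) := by
    intro j
    have ha := ResidualUnit.euclideanRow_ne_zero_of_rank_eq hA_rank j
    have hne_j : ∀ᶠ n in atTop, ResidualUnit.euclideanRow (Ahat n ω) j ≠ 0 := by
      filter_upwards [eventually_gt_atTop 0] with n hn h0
      exact hω_ne n hn j ((WithLp.toLp_eq_zero 2).1 h0)
    refine ResidualUnit.tendsto_rescaled_of_normalEquation ha hne_j
      (ResidualUnit.tendsto_normalize_of_halfspace ha hω_dense hne_j fun n i hi hle => ?_)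
      (ResidualUnit.integral_relu_inner_sq_pos hμ_moment hμ_supp ha) (hω_sq j) (hω_norm j)
      fun n m =>
        ResidualUnit.IsScaleFactor.normalEquation (z := fun i => Z i ω) (hω_k n m) j
    simpa only [max_eq_left hle] using
      ResidualUnit.IsQPLPSolution.inner_row_le (x := fun i => X i ω) (hω_A n) j hi
  refine tendsto_pi_nhds.2 fun j => tendsto_pi_nhds.2 fun l => ?_
  have hcoord : Tendsto (fun p : ℕ × ℕ => (khat p.1 p.2 ω j)⁻¹ * Ahat p.1 ω j l)
      (atTop ×ˢ atTop) (𝓝 (Astar j l)) :=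
    ((EuclideanSpace.proj (𝕜 := ℝ) l).continuous.tendsto _).comp (hrow j)
  simpa only [ResidualUnit.rescale, Matrix.of_apply, div_eq_inv_mul] using hcoord
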